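/- A binary-input output-symmetric (BIOS) channel consists of an output space $\mathcal{Y}$ (discrete or continuous) and transition mass or density functions $P(\cdot\mid 0)$, $P(\cdot\mid 1)$ on $\mathcal{Y}$, with respect to a $\sigma$-finite reference measure (such as counting or Lebesgue measure), such that $P(y\mid 1)=P(\pi(y)\mid 0)$ for all $y$, for some involution $\pi$ of $\mathcal{Y}$ that preserves the reference measure. It is used without memory: $P(\boldsymbol{y}\mid\boldsymbol{x})=\prod_t P(y_t\mid x_t)$. Its capacity $C$ is the maximum over all input distributions of the mutual information, in bits, between input and output. For $0<k\le n$ let $\mathscr{C}_s[n,k]$ be the ensemble of systematic binary linear codes with generator matrix $\mathbf{G}=[\mathbf{I}\ \mathbf{P}]$, where $\mathbf{I}$ is the $k\times k$ identity matrix and the entries of the $k\times(n-k)$ matrix $\mathbf{P}$ over $\mathbb{F}_2$ are independent and equal to $1$ with probability $\rho$. The information vector $\boldsymbol{U}$ is uniformly distributed over $\mathbb{F}_2^k$ and independent of $\mathbf{P}$, the codeword $\boldsymbol{U}\mathbf{G}$ is transmitted over the channel, and a decoder that knows $\mathbf{P}$ outputs an estimate $\hat{\boldsymbol{U}}$ from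 the received sequence. The bit error rate is $\mathrm{BER}=\frac1k\sum_{i=1}^{k}\Pr\{\hat U_i\neq U_i\}$, the probability being over $\mathbf{P}$, $\boldsymbol{U}$ and the channel. Maximum likelihood (ML) decoding outputs a vector $\boldsymbol{u}$ that maximizes $P(\boldsymbol{y}\mid\boldsymbol{u}\mathbf{G})$; maximum a posteriori (MAP) decoding outputs, for each $i$, a bit $b$ that maximizes $\Pr\{U_i=b\mid\boldsymbol{y}\}$. **Theorem.** Fix $0<\rho\le 1/2$. The ensemble $\mathscr{C}_s[n,k]$ achieves the capacity of every BIOS memoryless channel in terms of bit error rate: for every rate $0<R<C$ and every sequence of dimensions $k=k_n\le n$ with $\lim_{n\to\infty}k_n/n=R$, the bit error rate of $\mathscr{C}_s[n,k_n]$ tends to $0$ as $n\to\infty$, both under ML decoding and under bitwise MAP decoding, however ties are broken. -/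

import Mathlib

open Filter Topology MeasureTheory
open scoped NNReal ENNReal Matrix

noncomputable section

/-- A binary-input output-symmetric channel with output space `Y`: transition probability mass or
density functions `dens x` (`x` in the binary field) with respect to a reference measure `ref`
(counting measure for discrete outputs, Lebesgue measure for continuous ones), such that
`dens 1 y = dens 0 (π y)` for an involution `π` of `Y` that preserves the reference measure. -/
structure BIOSChannel (Y : Type*) [MeasurableSpace Y] where
  /-- the reference measure of the mass or density functions -/
  ref : Measure Y
  /-- the mass or density function `P(y|x)` -/
  dens : ZMod 2 → Y → ℝ≥0
  sigmaFinite_ref : SigmaFinite ref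
  measurable_dens : ∀ x, Measurable (dens x)
  lintegral_dens : ∀ x, ∫⁻ y, (dens x y : ℝ≥0∞) ∂ref = 1
  symmetric : ∃ π : Y → Y, Function.Involutive π ∧ MeasurePreserving π ref ref ∧
    ∀ y, dens 1 y = dens 0 (π y)

/-- A decoder for codes with `k` information and `m` parity positions: it
knows the matrix `P` and maps received sequences to estimates of the information
vector. -/
abbrev Decoder (Y : Type*) (k m : ℕ) : Type _ :=
  Matrix (Fin k) (Fin m) (ZMod 2) → (Fin k ⊕ Fin m → Y) → (Fin k → ZMod 2)

/-- All decision regions of the decoder are measurable. -/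
def Decoder.IsMeasurable {Y : Type*} [MeasurableSpace Y] {k m : ℕ} (d : Decoder Y k m) : Prop :=
  ∀ P u, MeasurableSet {y | d P y = u}

/-- The systematic generator matrix `G = [I P]`. -/
def generatorMatrix {k m : ℕ} (P : Matrix (Fin k) (Fin m) (ZMod 2)) :
    Matrix (Fin k) (Fin k ⊕ Fin m) (ZMod 2) :=
  Matrix.fromCols 1 P

/-- The codeword `u G = (u, u P)`. -/
def encode {k m : ℕ} (P : Matrix (Fin k) (Fin m) (ZMod 2)) (u : Fin k → ZMod 2) :
    Fin k ⊕ Fin m → ZMod 2 :=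
  u ᵥ* generatorMatrix P

/-- The probability of the matrix `P` when its entries are i.i.d. Bernoulli(`ρ`). -/
def matrixProb (ρ : ℝ) {k m : ℕ} (P : Matrix (Fin k) (Fin m) (ZMod 2)) : ℝ :=
  ∏ i, ∏ j, if P i j = 1 then ρ else 1 - ρ

namespace BIOSChannel

variable {Y : Type*} [MeasurableSpace Y]

/-- The output mass or density function `P_Y` when the input is `1` with probability `p`. -/
def outputDens (W : BIOSChannel Y) (p : ℝ) (y : Y) : ℝ :=
  (1 - p) * (W.dens 0 y : ℝ) + p * (W.dens 1 y : ℝ)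

/-- `I_x(p)`: the integral of `P(y|x) log₂ (P(y|x) / P_Y(y))`. -/
def partialInfo (W : BIOSChannel Y) (x : ZMod 2) (p : ℝ) : ℝ :=
  ∫ y, (W.dens x y : ℝ) * Real.logb 2 ((W.dens x y : ℝ) / W.outputDens p y) ∂W.ref

/-- The mutual information, in bits, between input and output when the input is `1` with
probability `p`. -/
def mutualInfo (W : BIOSChannel Y) (p : ℝ) : ℝ :=
  (1 - p) * W.partialInfo 0 p + p * W.partialInfo 1 p

/-- The channel capacity in bits: the maximal mutual information over all input distributions. -/
def capacity (W : BIOSChannel Y) : ℝ :=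
  ⨆ p : Set.Icc (0 : ℝ) 1, W.mutualInfo p

/-- The transition function of the memoryless channel: `P(y|x) = ∏ P(y_t|x_t)`. -/
def likelihood (W : BIOSChannel Y) {ι : Type*} [Fintype ι] (x : ι → ZMod 2) (y : ι → Y) : ℝ≥0 :=
  ∏ t, W.dens (x t) (y t)

/-- The law of the received sequence when `x` is sent over the memoryless channel. -/
def law (W : BIOSChannel Y) {ι : Type*} [Fintype ι] (x : ι → ZMod 2) : Measure (ι → Y) :=
  (Measure.pi fun _ : ι => W.ref).withDensity fun y => (W.likelihood x y : ℝ≥0∞)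

/-- Maximum likelihood decoding (ties broken arbitrarily). -/
def IsML (W : BIOSChannel Y) {k m : ℕ} (d : Decoder Y k m) : Prop :=
  ∀ P y u, W.likelihood (encode P u) y ≤ W.likelihood (encode P (d P y)) y

/-- The posterior probability that the `i`-th information bit is `b`, given the received sequence
`y`, for uniformly distributed information vectors. -/
def bitPosterior (W : BIOSChannel Y) {k m : ℕ} (P : Matrix (Fin k) (Fin m) (ZMod 2))
    (y : Fin k ⊕ Fin m → Y) (i : Fin k) (b : ZMod 2) : ℝ≥0 :=
  (∑ u : Fin k → ZMod 2 with u i = b, (1 / 2 ^ k) * W.likelihood (encode P u) y) /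
    ∑ u : Fin k → ZMod 2, (1 / 2 ^ k) * W.likelihood (encode P u) y

/-- Bitwise maximum a posteriori decoding (ties broken arbitrarily). -/
def IsMAP (W : BIOSChannel Y) {k m : ℕ} (d : Decoder Y k m) : Prop :=
  ∀ P y i b, W.bitPosterior P y i b ≤ W.bitPosterior P y i (d P y i)

/-- The bit error rate `(1/k) ∑ᵢ Pr{Ûᵢ ≠ Uᵢ}` of the systematic ensemble with parameter `ρ` used
with the decoder `d`: the probability is over the random matrix `P`, the uniformly distributed
information vector `u`, and the channel. -/
def ber (W : BIOSChannel Y) (ρ : ℝ) {k m : ℕ} (d : Decoder Y k m) : ℝ :=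
  (1 / (k : ℝ)) * ∑ i : Fin k,
    ∑ P : Matrix (Fin k) (Fin m) (ZMod 2), matrixProb ρ P *
      ∑ u : Fin k → ZMod 2, (1 / 2 ^ k) * (W.law (encode P u)).real {y | d P y i ≠ u i}

end BIOSChannel

end

/-! A sparse systematic ensemble may contain codewords of low weight, so block errors cannot be
excluded; but confusing `u` with `u + v` for `v` of weight below `h` costs at most `h / k` in bit
error rate. Only heavy `v` matter, and for these each parity bit of `v` has bias at most `(1 - 2ρ) ^
h`, which vanishes as `h` grows. The parity part is then nearly uniform and a random coding argument
applies.

By channel symmetry the zero codeword may be taken as sent. Given `y`, the probability over the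
matrix that a heavy competitor wins is at most 1, and the union bound controls its product with
`P(y|0)`. Interpolating with exponent `s` and integrating gives `((1 + (1 - 2ρ) ^ h) ^ m * 2 ^ k) ^
s` times the `n`-th power (`n = k + m`) of the integral of `P(·|0) ^ (1 - s) * Q ^ s`, where `Q` is
the output density for uniform input (`sum_matrixProb_law_heavyErrorEvent_le`). That integral is at
most `1 - s I + 32 s ^ 2`, with `I` the information of the uniform input in nats
(`integral_tilted_le`). By symmetry and Gibbs' inequality the uniform input is optimal
(`mutualInfo_le`), so below capacity a small fixed `s` gives exponential decay. With `h` about `ε k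
/ 2`, light errors cost at most `ε / 2`.

Bitwise MAP minimizes the bit error rate, so it does no worse than a measurable ML decoder. -/

/-! ### Scalar inequalities for powers and logarithms -/

/-- The remainder has this form because, at `x = -s log t` and after multiplication by `t`, it
becomes `s ^ 2 * log t ^ 2 * (t + t ^ (1 - s))`, which is bounded for `0 < t ≤ 2`. -/
theorem exp_le_one_add_add_sq_mul (x : ℝ) :
    Real.exp x ≤ 1 + x + x ^ 2 * (1 + Real.exp x) := by
  have hpos := Real.exp_pos x
  have h1 : 1 - x ≤ Real.exp (-x) := by linarith [Real.add_one_le_exp (-x)]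
  have h2 : Real.exp x * Real.exp (-x) = 1 := by rw [← Real.exp_add]; simp
  -- `exp x * (1 - x) ≤ 1`
  have h3 : Real.exp x * (1 - x) ≤ 1 := by nlinarith
  rcases le_total 0 x with hx | hx
  · have h4 : x * (Real.exp x * (1 - x)) ≤ x * 1 := mul_le_mul_of_nonneg_left h3 hx
    nlinarith [sq_nonneg x]
  · have h4 : 1 + x ≤ Real.exp x := by linarith [Real.add_one_le_exp x]
    -- `exp x ≤ 1 / (1 - x) ≤ 1 + x + x ^ 2`
    have h6 : (0 : ℝ) < 1 - x := by linarith
    have h7 : Real.exp x ≤ 1 + x + x ^ 2 := by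
      by_contra hcon
      push Not at hcon
      nlinarith [mul_lt_mul_of_pos_right hcon h6, pow_nonneg (neg_nonneg.2 hx) 3]
    nlinarith [mul_nonneg (sq_nonneg x) hpos.le]

theorem sq_log_mul_le {t s : ℝ} (ht : 0 < t) (ht2 : t ≤ 2) (hs : 0 ≤ s) (hs2 : s ≤ 1 / 2) :
    Real.log t ^ 2 * t ^ (1 - s) ≤ 16 := by
  rcases le_total t 1 with h1 | h1
  · have hle : t ^ (1 - s) ≤ t ^ (1 / 2 : ℝ) :=
      Real.rpow_le_rpow_of_exponent_ge ht h1 (by linarith)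
    have hu : 0 < t ^ (1 / 4 : ℝ) := Real.rpow_pos_of_pos ht _
    have hsq : t ^ (1 / 2 : ℝ) = (t ^ (1 / 4 : ℝ)) ^ 2 := by
      rw [← Real.rpow_natCast, ← Real.rpow_mul ht.le]; norm_num
    have hlog : Real.log t = 4 * Real.log (t ^ (1 / 4 : ℝ)) := by
      rw [Real.log_rpow ht]; ring
    set u := t ^ (1 / 4 : ℝ) with hudef
    have hu1 : u ≤ 1 := Real.rpow_le_one ht.le h1 (by norm_num)
    have hlu : |Real.log u * u| < 1 := Real.abs_log_mul_self_lt u hu hu1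
    have h2 : (Real.log u * u) ^ 2 ≤ 1 := by
      rw [← sq_abs]; nlinarith [abs_nonneg (Real.log u * u)]
    calc Real.log t ^ 2 * t ^ (1 - s) ≤ Real.log t ^ 2 * t ^ (1 / 2 : ℝ) :=
          mul_le_mul_of_nonneg_left hle (sq_nonneg _)
      _ = 16 * (Real.log u * u) ^ 2 := by rw [hlog, hsq]; ring
      _ ≤ 16 := by linarith
  · have hl0 : 0 ≤ Real.log t := Real.log_nonneg h1
    have hl1 : Real.log t ≤ 1 := by linarith [Real.log_le_sub_one_of_pos ht]
    have hle : t ^ (1 - s) ≤ t ^ (1 : ℝ) := Real.rpow_le_rpow_of_exponent_le h1 (by linarith)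
    rw [Real.rpow_one] at hle
    have h0 : 0 ≤ t ^ (1 - s) := Real.rpow_nonneg ht.le _
    have h2 : Real.log t ^ 2 ≤ 1 := by nlinarith
    nlinarith [mul_le_mul h2 hle h0 zero_le_one]

theorem rpow_one_sub_le {t s : ℝ} (ht : 0 < t) (ht2 : t ≤ 2) (hs : 0 ≤ s) (hs2 : s ≤ 1 / 2) :
    t ^ (1 - s) ≤ t - s * (t * Real.log t) + 32 * s ^ 2 := by
  have hexp : t ^ (1 - s) = t * Real.exp (-s * Real.log t) := by
    rw [Real.rpow_def_of_pos ht]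
    nth_rw 2 [← Real.exp_log ht]
    rw [← Real.exp_add]; ring_nf
  have hb := mul_le_mul_of_nonneg_left (exp_le_one_add_add_sq_mul (-s * Real.log t)) ht.le
  have h1 := sq_log_mul_le ht ht2 hs hs2
  have h2 := sq_log_mul_le ht ht2 le_rfl (by norm_num)
  rw [sub_zero, Real.rpow_one] at h2
  have h3 : t * (1 + -s * Real.log t + (-s * Real.log t) ^ 2 * (1 + Real.exp (-s * Real.log t)))
      = t - s * (t * Real.log t) + s ^ 2 * (Real.log t ^ 2 * t + Real.log t ^ 2 * t ^ (1 - s)) := by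
    rw [hexp]; ring
  rw [h3, ← hexp] at hb
  nlinarith [mul_le_mul_of_nonneg_left (add_le_add h1 h2) (sq_nonneg s)]

theorem rpow_mul_rpow_le {a q s : ℝ} (ha : 0 ≤ a) (hq : 0 ≤ q) (haq : a ≤ 2 * q)
    (hs : 0 < s) (hs2 : s ≤ 1 / 2) :
    a ^ (1 - s) * q ^ s ≤ a - s * (a * Real.log (a / q)) + 32 * s ^ 2 * q := by
  rcases ha.eq_or_lt with rfl | ha
  · rw [Real.zero_rpow (by linarith)]
    simp; positivity
  · have hq : 0 < q := by linarith
    have h := rpow_one_sub_le (t := a / q) (by positivity) (by rwa [div_le_iff₀ hq]) hs.le hs2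
    have h' := mul_le_mul_of_nonneg_right h hq.le
    have e1 : (a / q) ^ (1 - s) * q = a ^ (1 - s) * q ^ s := by
      rw [Real.div_rpow ha.le hq.le, div_mul_eq_mul_div, mul_div_assoc]
      congr 1
      nth_rw 1 [← Real.rpow_one q]
      rw [← Real.rpow_sub hq]; ring_nf
    rw [e1] at h'
    refine h'.trans (le_of_eq ?_)
    field_simp

/-- Supplies the integrable dominating function for the information density: `t log t` is bounded on
the bounded range `t = a / b ≤ 1 / c`. -/
theorem abs_mul_log_div_le {a b c : ℝ} (hc : 0 < c) (ha : 0 ≤ a) (hab : c * a ≤ b) :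
    |a * Real.log (a / b)| ≤ (1 + (1 / c) ^ 2) * b := by
  rcases ha.eq_or_lt with rfl | ha
  · simp at hab ⊢; positivity
  · have hb : 0 < b := lt_of_lt_of_le (by positivity) hab
    set t := a / b with ht
    have ht0 : 0 < t := by positivity
    have htc : t ≤ 1 / c := by
      rw [ht, div_le_div_iff₀ hb hc]; linarith
    have ha' : a = t * b := by rw [ht]; field_simp
    have key : t * |Real.log t| ≤ 1 + (1 / c) ^ 2 := by
      rcases le_total t 1 with h1 | h1
      · have := Real.abs_log_mul_self_lt t ht0 h1
        rw [abs_mul, abs_of_pos ht0] at this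
        nlinarith [sq_nonneg (1 / c)]
      · rw [abs_of_nonneg (Real.log_nonneg h1)]
        nlinarith [Real.log_le_sub_one_of_pos ht0]
    rw [ha', abs_mul, abs_of_pos (by positivity)]
    nlinarith

/-! ### Optimality of the uniform input and the tilted integral -/

namespace BIOSChannel

variable {Y : Type*} [MeasurableSpace Y] (W : BIOSChannel Y)

instance : SigmaFinite W.ref := W.sigmaFinite_ref

theorem measurable_dens_real (x : ZMod 2) : Measurable fun y => (W.dens x y : ℝ) :=
  (W.measurable_dens x).coe_nnreal_real

theorem integrable_dens (x : ZMod 2) : Integrable (fun y => (W.dens x y : ℝ)) W.ref := by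
  refine ⟨(W.measurable_dens_real x).aestronglyMeasurable, ?_⟩
  rw [hasFiniteIntegral_iff_enorm]
  simp [W.lintegral_dens x]

theorem integral_dens (x : ZMod 2) : ∫ y, (W.dens x y : ℝ) ∂W.ref = 1 := by
  rw [integral_eq_lintegral_of_nonneg_ae (ae_of_all _ fun y => NNReal.coe_nonneg _)
    (W.measurable_dens_real x).aestronglyMeasurable]
  simp [W.lintegral_dens x]

theorem integrable_outputDens (p : ℝ) : Integrable (W.outputDens p) W.ref :=
  ((W.integrable_dens 0).const_mul _).add ((W.integrable_dens 1).const_mul _)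

theorem integral_outputDens (p : ℝ) : ∫ y, W.outputDens p y ∂W.ref = 1 := by
  simp only [outputDens]
  rw [integral_add ((W.integrable_dens 0).const_mul _) ((W.integrable_dens 1).const_mul _),
    integral_const_mul, integral_const_mul, integral_dens, integral_dens]
  ring

theorem measurable_outputDens (p : ℝ) : Measurable (W.outputDens p) :=
  ((W.measurable_dens_real 0).const_mul _).add ((W.measurable_dens_real 1).const_mul _)

theorem integrable_dens_mul_log {x : ZMod 2} {p c : ℝ} (hc : 0 < c)
    (h : ∀ y, c * (W.dens x y : ℝ) ≤ W.outputDens p y) :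
    Integrable (fun y => (W.dens x y : ℝ) * Real.log ((W.dens x y : ℝ) / W.outputDens p y))
      W.ref := by
  refine ((W.integrable_outputDens p).const_mul (1 + (1 / c) ^ 2)).mono' ?_ (ae_of_all _ fun y => ?_)
  · exact ((W.measurable_dens_real x).mul (Real.measurable_log.comp
      ((W.measurable_dens_real x).div (W.measurable_outputDens p)))).aestronglyMeasurable
  · exact abs_mul_log_div_le hc (NNReal.coe_nonneg _) (h y)

theorem partialInfo_eq (x : ZMod 2) (p : ℝ) :
    W.partialInfo x p =
      (∫ y, (W.dens x y : ℝ) * Real.log ((W.dens x y : ℝ) / W.outputDens p y) ∂W.ref) /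
        Real.log 2 := by
  simp only [partialInfo, Real.logb, ← mul_div_assoc, integral_div]

theorem half_mul_dens_le (x : ZMod 2) (y : Y) :
    1 / 2 * (W.dens x y : ℝ) ≤ W.outputDens (1 / 2) y := by
  have h0 := NNReal.coe_nonneg (W.dens 0 y)
  have h1 := NNReal.coe_nonneg (W.dens 1 y)
  simp only [outputDens]
  rcases (by decide : ∀ x : ZMod 2, x = 0 ∨ x = 1) x with rfl | rfl <;> linarith

/-- The involution exchanges the two densities and fixes their average, so a change of variables
suffices. -/
theorem partialInfo_half_one : W.partialInfo 1 (1 / 2) = W.partialInfo 0 (1 / 2) := by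
  obtain ⟨π, hinv, hπ, hsym⟩ := W.symmetric
  have h0 : ∀ y, W.dens 1 (π y) = W.dens 0 y := fun y => by rw [hsym, hinv y]
  let e : Y ≃ᵐ Y := ⟨hinv.toPerm, hπ.measurable, hπ.measurable⟩
  have he : MeasurePreserving e W.ref W.ref := hπ
  simp only [partialInfo]
  rw [← he.integral_comp e.measurableEmbedding]
  refine integral_congr_ae (ae_of_all _ fun y => ?_)
  have : e y = π y := rfl
  simp only [outputDens, this, h0, ← hsym]
  ring_nf

/-- Replacing the true output density by the uniform-input one in the logarithm adds a
Kullback–Leibler divergence, which is nonnegative. The resulting average does not depend on `p`, by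
symmetry. Endpoints are left out because the domination of the densities by the output density needs
positive weights. -/
theorem mutualInfo_le {p : ℝ} (h0 : 0 < p) (h1 : p < 1) :
    W.mutualInfo p ≤ W.partialInfo 0 (1 / 2) := by
  have hp : 0 < 1 - p := by linarith
  have hlog : 0 < Real.log 2 := Real.log_pos (by norm_num)
  have hrhs : W.partialInfo 0 (1 / 2) =
      (1 - p) * W.partialInfo 0 (1 / 2) + p * W.partialInfo 1 (1 / 2) := by
    rw [partialInfo_half_one]; ring
  have hnn : ∀ x y, 0 ≤ (W.dens x y : ℝ) := fun x y => NNReal.coe_nonneg _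
  have i0 := W.integrable_dens_mul_log (x := 0) (p := p) hp fun y => by
    have := mul_nonneg h0.le (hnn 1 y); simp only [outputDens]; linarith
  have i1 := W.integrable_dens_mul_log (x := 1) (p := p) h0 fun y => by
    have := mul_nonneg hp.le (hnn 0 y); simp only [outputDens]; linarith
  have j0 := W.integrable_dens_mul_log one_half_pos (W.half_mul_dens_le 0)
  have j1 := W.integrable_dens_mul_log one_half_pos (W.half_mul_dens_le 1)
  rw [hrhs, mutualInfo]
  simp only [partialInfo_eq, ← mul_div_assoc, ← add_div]
  refine div_le_div_of_nonneg_right ?_ hlog.le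
  simp only [← integral_const_mul]
  rw [← integral_add (i0.const_mul _) (i1.const_mul _),
    ← integral_add (j0.const_mul _) (j1.const_mul _)]
  -- Adding this zero integral makes the comparison pointwise, by `log z ≤ z - 1`.
  have hz : ∫ y, (W.outputDens (1 / 2) y - W.outputDens p y) ∂W.ref = 0 := by
    rw [integral_sub (W.integrable_outputDens _) (W.integrable_outputDens _),
      integral_outputDens, integral_outputDens, sub_self]
  rw [← add_zero (∫ y, _ + _ * (_ * Real.log (_ / W.outputDens (1 / 2) y)) ∂W.ref), ← hz]
  have hJ := (j0.const_mul (1 - p)).add (j1.const_mul p)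
  have hD := (W.integrable_outputDens (1 / 2)).sub (W.integrable_outputDens p)
  refine (integral_mono ((i0.const_mul (1 - p)).add (i1.const_mul p)) (hJ.add hD)
    fun y => ?_).trans_eq (integral_add' hJ hD)
  have ha := hnn 0 y
  have hb := hnn 1 y
  have eP : W.outputDens p y = (1 - p) * W.dens 0 y + p * W.dens 1 y := rfl
  have eQ : W.outputDens (1 / 2) y = (1 - 1 / 2) * W.dens 0 y + 1 / 2 * W.dens 1 y := rfl
  simp only [Pi.add_apply, Pi.sub_apply]
  generalize (W.dens 0 y : ℝ) = a at *
  generalize (W.dens 1 y : ℝ) = b at *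
  generalize W.outputDens p y = P at *
  generalize W.outputDens (1 / 2) y = Q at *
  by_cases hP : P = 0
  · have ha0 : a = 0 := by nlinarith [mul_nonneg hp.le ha, mul_nonneg h0.le hb]
    have hb0 : b = 0 := by nlinarith [mul_nonneg hp.le ha, mul_nonneg h0.le hb]
    simp [hP, ha0, hb0, eQ]
  have hP : 0 < P := lt_of_le_of_ne (by rw [eP]; positivity) (Ne.symm hP)
  have hQ : 0 < Q := by
    rcases ha.eq_or_lt with h | h
    · rcases hb.eq_or_lt with h' | h'
      · rw [← h, ← h'] at eP; simp at eP; linarith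
      · linarith
    · linarith
  have hl : ∀ c : ℝ, 0 ≤ c → c * Real.log (c / P) = c * Real.log (c / Q) + c * Real.log (Q / P) := by
    intro c hc
    rcases hc.eq_or_lt with rfl | hc
    · simp
    · rw [Real.log_div hc.ne' hP.ne', Real.log_div hc.ne' hQ.ne', Real.log_div hQ.ne' hP.ne']; ring
  rw [hl a ha, hl b hb]
  have h2 : P * Real.log (Q / P) ≤ Q - P := by
    have := mul_le_mul_of_nonneg_left (Real.log_le_sub_one_of_pos (div_pos hQ hP)) hP.le
    rwa [mul_sub, mul_div_cancel₀ _ hP.ne', mul_one] at this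
  rw [eP] at h2 ⊢
  nlinarith

theorem mutualInfo_zero : W.mutualInfo 0 = 0 := by
  have : ∀ t : ℝ, t * Real.logb 2 (t / t) = 0 := fun t => by
    by_cases h : t = 0 <;> simp [h]
  simp [mutualInfo, partialInfo, outputDens, this]

theorem mutualInfo_one : W.mutualInfo 1 = 0 := by
  have : ∀ t : ℝ, t * Real.logb 2 (t / t) = 0 := fun t => by
    by_cases h : t = 0 <;> simp [h]
  simp [mutualInfo, partialInfo, outputDens, this]

/-- Every positive rate below capacity is below the mutual information of the uniform input. -/
theorem lt_partialInfo_half {R : ℝ} (hR : 0 < R) (h : R < W.capacity) :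
    R < W.partialInfo 0 (1 / 2) := by
  obtain ⟨⟨p, hp0, hp1⟩, hp⟩ := exists_lt_of_lt_ciSup h
  simp only at hp
  -- Deterministic inputs carry no information, so `R > 0` rules them out.
  rcases hp0.eq_or_lt with rfl | h0
  · rw [mutualInfo_zero] at hp; linarith
  rcases hp1.eq_or_lt with rfl | h1
  · rw [mutualInfo_one] at hp; linarith
  exact hp.trans_le (W.mutualInfo_le h0 h1)

/-- The integrand of the exponential moment of the information density. -/
noncomputable def tilted (s : ℝ) (y : Y) : ℝ :=
  (W.dens 0 y : ℝ) ^ (1 - s) * (W.outputDens (1 / 2) y) ^ s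

theorem outputDens_half_nonneg (y : Y) : 0 ≤ W.outputDens (1 / 2) y :=
  le_trans (by positivity) (W.half_mul_dens_le 0 y)

theorem tilted_nonneg (s : ℝ) (y : Y) : 0 ≤ W.tilted s y :=
  mul_nonneg (Real.rpow_nonneg (NNReal.coe_nonneg _) _)
    (Real.rpow_nonneg (W.outputDens_half_nonneg y) _)

theorem tilted_le {s : ℝ} (hs : 0 < s) (hs2 : s ≤ 1 / 2) (y : Y) :
    W.tilted s y ≤ (W.dens 0 y : ℝ)
      - s * ((W.dens 0 y : ℝ) * Real.log ((W.dens 0 y : ℝ) / W.outputDens (1 / 2) y))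
      + 32 * s ^ 2 * W.outputDens (1 / 2) y :=
  rpow_mul_rpow_le (NNReal.coe_nonneg _) (W.outputDens_half_nonneg y)
    (by linarith [W.half_mul_dens_le 0 y]) hs hs2

theorem integrable_tilted {s : ℝ} (hs : 0 < s) (hs2 : s ≤ 1 / 2) :
    Integrable (W.tilted s) W.ref := by
  refine (((W.integrable_dens 0).sub ((W.integrable_dens_mul_log one_half_pos
    (W.half_mul_dens_le 0)).const_mul s)).add
      ((W.integrable_outputDens (1 / 2)).const_mul (32 * s ^ 2))).mono' ?_ (ae_of_all _ fun y => ?_)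
  · exact (((W.measurable_dens_real 0).pow_const _).mul
      ((W.measurable_outputDens _).pow_const _)).aestronglyMeasurable
  · rw [Real.norm_of_nonneg (W.tilted_nonneg s y)]
    exact W.tilted_le hs hs2 y

theorem integral_tilted_le {s : ℝ} (hs : 0 < s) (hs2 : s ≤ 1 / 2) :
    ∫ y, W.tilted s y ∂W.ref ≤
      1 - s * (W.partialInfo 0 (1 / 2) * Real.log 2) + 32 * s ^ 2 := by
  have j0 := W.integrable_dens_mul_log one_half_pos (W.half_mul_dens_le 0)
  have hlog : Real.log 2 ≠ 0 := (Real.log_pos (by norm_num)).ne'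
  have h := integral_mono (W.integrable_tilted hs hs2)
    (((W.integrable_dens 0).sub (j0.const_mul s)).add
      ((W.integrable_outputDens (1 / 2)).const_mul (32 * s ^ 2))) (W.tilted_le hs hs2)
  refine (h.trans_eq (integral_add' ((W.integrable_dens 0).sub (j0.const_mul s))
    ((W.integrable_outputDens (1 / 2)).const_mul (32 * s ^ 2)))).trans_eq ?_
  rw [integral_sub' (W.integrable_dens 0) (j0.const_mul s), integral_const_mul, integral_const_mul,
    integral_outputDens, integral_dens, partialInfo_eq, div_mul_cancel₀ _ hlog, mul_one]

end BIOSChannel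

/-! ### The random parity matrix -/

theorem matrixProb_nonneg {ρ : ℝ} (h0 : 0 ≤ ρ) (h1 : ρ ≤ 1) {k m : ℕ}
    (P : Matrix (Fin k) (Fin m) (ZMod 2)) : 0 ≤ matrixProb ρ P :=
  Finset.prod_nonneg fun i _ => Finset.prod_nonneg fun j _ => by split_ifs <;> linarith

theorem ZMod.sum_univ_two {M : Type*} [AddCommMonoid M] (f : ZMod 2 → M) :
    ∑ a, f a = f 0 + f 1 :=
  Fin.sum_univ_two f

/-- The sum of a product of column functions over all matrices is the product of the column sums. -/
theorem Matrix.sum_prod_col {κ ι α : Type*} [Fintype κ] [Fintype ι] [Fintype α] [DecidableEq κ]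
    [DecidableEq ι] (F : ι → (κ → α) → ℝ) :
    ∑ P : Matrix κ ι α, ∏ j, F j (fun i => P i j) = ∏ j, ∑ p : κ → α, F j p := by
  rw [Fintype.prod_sum]
  exact Fintype.sum_equiv (Equiv.piComm fun _ _ => α) _ _ fun P => rfl

theorem sum_prod_bernoulli (ρ : ℝ) (k : ℕ) :
    ∑ p : Fin k → ZMod 2, (∏ i, if p i = 1 then ρ else 1 - ρ) = 1 := by
  rw [← Fintype.prod_sum (fun (_ : Fin k) (a : ZMod 2) => if a = 1 then ρ else 1 - ρ)]
  refine Finset.prod_eq_one fun i _ => ?_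
  rw [ZMod.sum_univ_two]; simp

theorem sum_matrixProb (ρ : ℝ) (k m : ℕ) :
    ∑ P : Matrix (Fin k) (Fin m) (ZMod 2), matrixProb ρ P = 1 := by
  have h : ∀ P : Matrix (Fin k) (Fin m) (ZMod 2), matrixProb ρ P =
      ∏ j, (fun p : Fin k → ZMod 2 => ∏ i, if p i = 1 then ρ else 1 - ρ) (fun i => P i j) :=
    fun P => Finset.prod_comm
  simp only [h]
  rw [Matrix.sum_prod_col (fun _ (p : Fin k → ZMod 2) => ∏ i, if p i = 1 then ρ else 1 - ρ)]
  exact Finset.prod_eq_one fun j _ => sum_prod_bernoulli ρ k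

/-- The nontrivial character of the binary field. -/
def binaryChar (a : ZMod 2) : ℝ := if a = 1 then -1 else 1

theorem binaryChar_add (a b : ZMod 2) : binaryChar (a + b) = binaryChar a * binaryChar b := by
  revert a b
  have h : ∀ a : ZMod 2, a = 0 ∨ a = 1 := by decide
  intro a b
  have h2 : (1 + 1 : ZMod 2) = 0 := by decide
  rcases h a with rfl | rfl <;> rcases h b with rfl | rfl <;> simp [binaryChar, h2]

theorem binaryChar_sum {ι : Type*} (s : Finset ι) (f : ι → ZMod 2) :
    binaryChar (∑ i ∈ s, f i) = ∏ i ∈ s, binaryChar (f i) := by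
  classical
  induction s using Finset.induction_on with
  | empty => simp [binaryChar]
  | insert a s ha ih => rw [Finset.sum_insert ha, Finset.prod_insert ha, binaryChar_add, ih]

theorem ite_eq_binaryChar (a z : ZMod 2) :
    (if a = z then (1 : ℝ) else 0) = (1 + binaryChar z * binaryChar a) / 2 := by
  have h : ∀ a : ZMod 2, a = 0 ∨ a = 1 := by decide
  rcases h a with rfl | rfl <;> rcases h z with rfl | rfl <;> simp [binaryChar]

/-- A sum of `hammingNorm v` independent Bernoulli(`ρ`) bits is nearly uniform. -/
theorem sum_bernoulli_dotProduct_le {ρ : ℝ} (h1 : ρ ≤ 1 / 2) {k : ℕ}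
    (v : Fin k → ZMod 2) (z : ZMod 2) :
    ∑ p : Fin k → ZMod 2, (∏ i, if p i = 1 then ρ else 1 - ρ) *
      (if v ⬝ᵥ p = z then 1 else 0) ≤ (1 + (1 - 2 * ρ) ^ hammingNorm v) / 2 := by
  have hone := sum_prod_bernoulli ρ k
  -- The mean of the character factors over coordinates: each `i` in the support of `v` contributes
  -- `1 - 2ρ`, every other one contributes 1.
  have hchar : ∑ p : Fin k → ZMod 2, (∏ i, if p i = 1 then ρ else 1 - ρ) *
      binaryChar (v ⬝ᵥ p) = (1 - 2 * ρ) ^ hammingNorm v := by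
    simp only [dotProduct, binaryChar_sum, ← Finset.prod_mul_distrib]
    rw [← Fintype.prod_sum (fun (i : Fin k) (a : ZMod 2) =>
      (if a = 1 then ρ else 1 - ρ) * binaryChar (v i * a)), hammingNorm, ← Finset.prod_const,
      Finset.prod_filter]
    refine Finset.prod_congr rfl fun i _ => ?_
    rw [ZMod.sum_univ_two]
    rcases (by decide : ∀ a : ZMod 2, a = 0 ∨ a = 1) (v i) with h | h <;>
      simp [h, binaryChar]; ring
  have hsum : ∑ p : Fin k → ZMod 2, (∏ i, if p i = 1 then ρ else 1 - ρ) *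
      (if v ⬝ᵥ p = z then 1 else 0) = (1 + binaryChar z * (1 - 2 * ρ) ^ hammingNorm v) / 2 := by
    simp only [ite_eq_binaryChar, ← mul_div_assoc, mul_add, mul_one]
    rw [← Finset.sum_div, Finset.sum_add_distrib, hone, ← hchar, Finset.mul_sum]
    congr 2
    exact Finset.sum_congr rfl fun p _ => by ring
  rw [hsum]
  have hb : binaryChar z ≤ 1 := by unfold binaryChar; split_ifs <;> norm_num
  have hp : 0 ≤ (1 - 2 * ρ) ^ hammingNorm v := pow_nonneg (by linarith) _
  nlinarith

/-- The columns of the matrix are independent, so the single-bit bounds multiply. -/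
theorem sum_matrixProb_vecMul_le {ρ : ℝ} (h0 : 0 ≤ ρ) (h1 : ρ ≤ 1 / 2) {k m : ℕ}
    (v : Fin k → ZMod 2) (z : Fin m → ZMod 2) :
    ∑ P : Matrix (Fin k) (Fin m) (ZMod 2), matrixProb ρ P * (if v ᵥ* P = z then 1 else 0) ≤
      ((1 + (1 - 2 * ρ) ^ hammingNorm v) / 2) ^ m := by
  have h : ∀ P : Matrix (Fin k) (Fin m) (ZMod 2),
      matrixProb ρ P * (if v ᵥ* P = z then 1 else 0) =
      ∏ j, (fun p : Fin k → ZMod 2 => (∏ i, if p i = 1 then ρ else 1 - ρ) *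
        (if v ⬝ᵥ p = z j then 1 else 0)) (fun i => P i j) := by
    intro P
    rw [Finset.prod_mul_distrib, matrixProb, Finset.prod_comm, Finset.prod_boole]
    congr 1
    simp only [funext_iff, Finset.mem_univ, true_imp_iff]
    rfl
  simp only [h]
  rw [Matrix.sum_prod_col (fun j (p : Fin k → ZMod 2) => (∏ i, if p i = 1 then ρ else 1 - ρ) *
        (if v ⬝ᵥ p = z j then 1 else 0))]
  refine (Finset.prod_le_prod (fun j _ => Finset.sum_nonneg fun p _ => mul_nonneg
    (Finset.prod_nonneg fun i _ => by split_ifs <;> linarith) (by split_ifs <;> norm_num))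
    fun j _ => sum_bernoulli_dotProduct_le h1 v (z j)).trans ?_
  simp [div_pow]

theorem encode_eq {k m : ℕ} (P : Matrix (Fin k) (Fin m) (ZMod 2)) (u : Fin k → ZMod 2) :
    encode P u = Sum.elim u (u ᵥ* P) := by
  rw [encode, generatorMatrix, Matrix.vecMul_fromCols, Matrix.vecMul_one]

theorem encode_add {k m : ℕ} (P : Matrix (Fin k) (Fin m) (ZMod 2)) (u v : Fin k → ZMod 2) :
    encode P (u + v) = encode P u + encode P v :=
  Matrix.add_vecMul _ _ _

namespace BIOSChannel

variable {Y : Type*} [MeasurableSpace Y] (W : BIOSChannel Y)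

theorem sum_likelihood {ι : Type*} [Fintype ι] [DecidableEq ι] (y : ι → Y) :
    ∑ x : ι → ZMod 2, (W.likelihood x y : ℝ) = ∏ t, (2 * W.outputDens (1 / 2) (y t)) := by
  simp only [likelihood, NNReal.coe_prod]
  rw [← Fintype.prod_sum (fun (t : ι) (a : ZMod 2) => (W.dens a (y t) : ℝ))]
  refine Finset.prod_congr rfl fun t _ => ?_
  rw [ZMod.sum_univ_two, outputDens]; ring

/-- The ensemble average of the likelihood of the codewords with heavy information part. -/
theorem sum_matrixProb_likelihood_le {ρ : ℝ} (h0 : 0 ≤ ρ) (h1 : ρ ≤ 1 / 2) {k m : ℕ} (h : ℕ)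
    (y : Fin k ⊕ Fin m → Y) :
    ∑ P : Matrix (Fin k) (Fin m) (ZMod 2), matrixProb ρ P *
      ∑ v : Fin k → ZMod 2 with h ≤ hammingNorm v, (W.likelihood (encode P v) y : ℝ) ≤
    ((1 + (1 - 2 * ρ) ^ h) / 2) ^ m * ∏ t, (2 * W.outputDens (1 / 2) (y t)) := by
  have key : ∀ v : Fin k → ZMod 2, h ≤ hammingNorm v →
      ∑ P : Matrix (Fin k) (Fin m) (ZMod 2), matrixProb ρ P * (W.likelihood (encode P v) y : ℝ) ≤
        ((1 + (1 - 2 * ρ) ^ h) / 2) ^ m *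
          ∑ z : Fin m → ZMod 2, (W.likelihood (Sum.elim v z) y : ℝ) := by
    intro v hv
    have e : ∀ P : Matrix (Fin k) (Fin m) (ZMod 2),
        matrixProb ρ P * (W.likelihood (encode P v) y : ℝ) =
        ∑ z : Fin m → ZMod 2, (matrixProb ρ P * if v ᵥ* P = z then 1 else 0) *
          (W.likelihood (Sum.elim v z) y : ℝ) := by
      intro P
      simp [encode_eq]
    simp only [e]
    rw [Finset.sum_comm, Finset.mul_sum]
    refine Finset.sum_le_sum fun z _ => ?_
    rw [← Finset.sum_mul]
    refine mul_le_mul_of_nonneg_right ?_ (NNReal.coe_nonneg _)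
    refine (sum_matrixProb_vecMul_le h0 h1 v z).trans ?_
    have hδ0 : 0 ≤ 1 - 2 * ρ := by linarith
    have := pow_le_pow_of_le_one hδ0 (by linarith) hv
    have := pow_nonneg hδ0 (hammingNorm v)
    gcongr
  simp only [Finset.mul_sum]
  rw [Finset.sum_comm, ← W.sum_likelihood y]
  refine (Finset.sum_le_sum fun v hv => key v (Finset.mem_filter.1 hv).2).trans ?_
  rw [← Finset.mul_sum]
  have hδ0 : 0 ≤ 1 - 2 * ρ := by linarith
  refine mul_le_mul_of_nonneg_left ?_ (by positivity)
  -- Once the weight has entered the constant, the restriction on `v` is dropped; the pairs `(v, z)`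
  -- then run over all words.
  refine (Finset.sum_le_sum_of_subset_of_nonneg (Finset.filter_subset _ _) fun v _ _ =>
    Finset.sum_nonneg fun z _ => NNReal.coe_nonneg _).trans_eq ?_
  rw [← Fintype.sum_prod_type']
  exact Fintype.sum_equiv (Equiv.sumArrowEquivProdArrow _ _ _).symm _ _ fun _ => rfl

end BIOSChannel

/-! ### Heavy error events -/

namespace BIOSChannel

variable {Y : Type*} [MeasurableSpace Y] (W : BIOSChannel Y)

theorem measurable_likelihood {ι : Type*} [Fintype ι] (x : ι → ZMod 2) :
    Measurable (W.likelihood x) := by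
  unfold likelihood
  exact Finset.measurable_fun_prod _ fun t _ => (W.measurable_dens _).comp (measurable_pi_apply t)

theorem integrable_likelihood {ι : Type*} [Fintype ι] (x : ι → ZMod 2) :
    Integrable (fun y => (W.likelihood x y : ℝ)) (Measure.pi fun _ : ι => W.ref) := by
  simp only [likelihood, NNReal.coe_prod]
  exact Integrable.fintype_prod fun t => W.integrable_dens (x t)

theorem integral_likelihood {ι : Type*} [Fintype ι] (x : ι → ZMod 2) :
    ∫ y, (W.likelihood x y : ℝ) ∂(Measure.pi fun _ : ι => W.ref) = 1 := by
  simp only [likelihood, NNReal.coe_prod]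
  rw [integral_fintype_prod_eq_prod (fun t y => (W.dens (x t) y : ℝ))]
  simp [integral_dens]

theorem law_real {ι : Type*} [Fintype ι] (x : ι → ZMod 2) {S : Set (ι → Y)}
    (hS : MeasurableSet S) :
    (W.law x).real S =
      ∫ y, S.indicator (fun y => (W.likelihood x y : ℝ)) y ∂(Measure.pi fun _ : ι => W.ref) := by
  rw [integral_indicator hS, Measure.real, law, withDensity_apply _ hS,
    integral_eq_lintegral_of_nonneg_ae (ae_of_all _ fun y => NNReal.coe_nonneg _)
      (W.measurable_likelihood x).coe_nnreal_real.aestronglyMeasurable]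
  simp

instance {ι : Type*} [Fintype ι] (x : ι → ZMod 2) : IsProbabilityMeasure (W.law x) := by
  constructor
  have h := W.law_real x MeasurableSet.univ
  rw [Set.indicator_univ, integral_likelihood, Measure.real] at h
  rw [← ENNReal.toReal_eq_one_iff, h]

/-- The received sequences for which some codeword whose information vector differs from the
transmitted one in at least `h` positions is at least as likely as the transmitted codeword `x`. -/
def heavyErrorEvent {k m : ℕ} (h : ℕ) (P : Matrix (Fin k) (Fin m) (ZMod 2))
    (x : Fin k ⊕ Fin m → ZMod 2) : Set (Fin k ⊕ Fin m → Y) :=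
  {y | ∃ v : Fin k → ZMod 2, h ≤ hammingNorm v ∧
    W.likelihood x y ≤ W.likelihood (x + encode P v) y}

theorem measurableSet_heavyErrorEvent {k m : ℕ} (h : ℕ) (P : Matrix (Fin k) (Fin m) (ZMod 2))
    (x : Fin k ⊕ Fin m → ZMod 2) : MeasurableSet (W.heavyErrorEvent h P x) := by
  simp only [heavyErrorEvent, Set.ofPred_exists]
  refine MeasurableSet.iUnion fun v => ?_
  have hle : MeasurableSet {y | W.likelihood x y ≤ W.likelihood (x + encode P v) y} :=
    measurableSet_le (W.measurable_likelihood x) (W.measurable_likelihood (x + encode P v))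
  exact (MeasurableSet.const (h ≤ hammingNorm v)).inter hle

/-- Geometric interpolation between `a * b ≤ a` and `a * b ≤ K`. -/
theorem mul_le_rpow_mul_rpow {a b K s : ℝ} (ha : 0 ≤ a) (hb : 0 ≤ b) (hb1 : b ≤ 1)
    (hK : a * b ≤ K) (hs : 0 ≤ s) (hs1 : s ≤ 1) : a * b ≤ a ^ (1 - s) * K ^ s := by
  have hab : 0 ≤ a * b := mul_nonneg ha hb
  calc a * b = (a * b) ^ (1 - s) * (a * b) ^ s := by
        rw [← Real.rpow_add' hab (by norm_num)]; simp
    _ ≤ a ^ (1 - s) * K ^ s := by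
        gcongr
        · nlinarith

theorem sum_matrixProb_indicator_le {ρ : ℝ} (h0 : 0 ≤ ρ) (h1 : ρ ≤ 1 / 2) {k m : ℕ} (h : ℕ)
    {s : ℝ} (hs : 0 ≤ s) (hs1 : s ≤ 1) (y : Fin k ⊕ Fin m → Y) :
    ∑ P : Matrix (Fin k) (Fin m) (ZMod 2), matrixProb ρ P *
      (W.heavyErrorEvent h P 0).indicator (fun y => (W.likelihood 0 y : ℝ)) y ≤
    ((1 + (1 - 2 * ρ) ^ h) ^ m * 2 ^ k) ^ s * ∏ t, W.tilted s (y t) := by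
  classical
  have hδ : 0 ≤ (1 - 2 * ρ) ^ h := pow_nonneg (by linarith) _
  have hμ : ∀ P : Matrix (Fin k) (Fin m) (ZMod 2), 0 ≤ matrixProb ρ P :=
    fun P => matrixProb_nonneg h0 (by linarith) P
  -- `B` is the probability, over the matrix alone, that `y` lies in the heavy error event.
  set B : ℝ := ∑ P : Matrix (Fin k) (Fin m) (ZMod 2), matrixProb ρ P *
    (if y ∈ W.heavyErrorEvent h P 0 then 1 else 0) with hB
  have hB0 : 0 ≤ B := Finset.sum_nonneg fun P _ => mul_nonneg (hμ P) (by split_ifs <;> norm_num)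
  have hB1 : B ≤ 1 := by
    rw [← sum_matrixProb ρ k m]
    refine Finset.sum_le_sum fun P _ => ?_
    split_ifs
    · simp
    · simpa using hμ P
  have hlhs : ∑ P : Matrix (Fin k) (Fin m) (ZMod 2), matrixProb ρ P *
      (W.heavyErrorEvent h P 0).indicator (fun y => (W.likelihood 0 y : ℝ)) y =
      (W.likelihood 0 y : ℝ) * B := by
    rw [hB, Finset.mul_sum]
    refine Finset.sum_congr rfl fun P _ => ?_
    rw [Set.indicator_apply]
    split_ifs <;> ring
  -- Union bound: on the event, some heavy codeword has likelihood at least that of zero, and the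
  -- sum over all of them is larger still.
  have hK : (W.likelihood 0 y : ℝ) * B ≤
      ((1 + (1 - 2 * ρ) ^ h) / 2) ^ m * ∏ t, (2 * W.outputDens (1 / 2) (y t)) := by
    refine le_trans ?_ (W.sum_matrixProb_likelihood_le h0 h1 h y)
    rw [← hlhs]
    refine Finset.sum_le_sum fun P _ => mul_le_mul_of_nonneg_left ?_ (hμ P)
    rw [Set.indicator_apply]
    split_ifs with hy
    · obtain ⟨v, hv, hle⟩ := hy
      rw [zero_add] at hle
      refine le_trans (NNReal.coe_le_coe.2 hle) ?_
      exact Finset.single_le_sum (f := fun v => (W.likelihood (encode P v) y : ℝ))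
        (fun v _ => NNReal.coe_nonneg _) (Finset.mem_filter.2 ⟨Finset.mem_univ v, hv⟩)
    · exact Finset.sum_nonneg fun v _ => NNReal.coe_nonneg _
  rw [hlhs]
  refine (mul_le_rpow_mul_rpow (NNReal.coe_nonneg _) hB0 hB1 hK hs hs1).trans_eq ?_
  have hQ : ∀ t, 0 ≤ W.outputDens (1 / 2) (y t) := fun t => W.outputDens_half_nonneg _
  have hconst : ((1 + (1 - 2 * ρ) ^ h) / 2) ^ m * ∏ t, (2 * W.outputDens (1 / 2) (y t)) =
      ((1 + (1 - 2 * ρ) ^ h) ^ m * 2 ^ k) * ∏ t, W.outputDens (1 / 2) (y t) := by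
    rw [Finset.prod_mul_distrib, div_pow]
    simp [pow_add]
    field_simp
  rw [hconst, Real.mul_rpow (by positivity) (Finset.prod_nonneg fun t _ => hQ t)]
  simp only [tilted, Finset.prod_mul_distrib, likelihood, NNReal.coe_prod]
  rw [Real.finsetProd_rpow _ _ (fun t _ => hQ t),
    Real.finsetProd_rpow _ _ (fun t _ => NNReal.coe_nonneg _)]
  simp only [Pi.zero_apply]
  ring

/-- Gallager-type bound on the ensemble average probability of a heavy error event. -/
theorem sum_matrixProb_law_heavyErrorEvent_le {ρ : ℝ} (h0 : 0 ≤ ρ) (h1 : ρ ≤ 1 / 2) {k m : ℕ}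
    (h : ℕ) {s : ℝ} (hs : 0 < s) (hs2 : s ≤ 1 / 2) :
    ∑ P : Matrix (Fin k) (Fin m) (ZMod 2), matrixProb ρ P *
      (W.law 0).real (W.heavyErrorEvent h P 0) ≤
    ((1 + (1 - 2 * ρ) ^ h) ^ m * 2 ^ k) ^ s * (∫ y, W.tilted s y ∂W.ref) ^ (k + m) := by
  have hint : ∀ P : Matrix (Fin k) (Fin m) (ZMod 2), Integrable (fun y => matrixProb ρ P *
      (W.heavyErrorEvent h P 0).indicator (fun y => (W.likelihood 0 y : ℝ)) y)
      (Measure.pi fun _ : Fin k ⊕ Fin m => W.ref) := fun P =>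
    ((W.integrable_likelihood 0).indicator (W.measurableSet_heavyErrorEvent h P 0)).const_mul _
  have e : ∀ P : Matrix (Fin k) (Fin m) (ZMod 2),
      matrixProb ρ P * (W.law 0).real (W.heavyErrorEvent h P 0) =
      ∫ y, matrixProb ρ P *
        (W.heavyErrorEvent h P 0).indicator (fun y => (W.likelihood 0 y : ℝ)) y
        ∂(Measure.pi fun _ : Fin k ⊕ Fin m => W.ref) := fun P => by
    rw [W.law_real 0 (W.measurableSet_heavyErrorEvent h P 0), integral_const_mul]
  simp only [e]
  rw [← integral_finsetSum _ fun P _ => hint P]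
  refine (integral_mono (integrable_finsetSum _ fun P _ => hint P)
    ((Integrable.fintype_prod fun _ => W.integrable_tilted hs hs2).const_mul
      (((1 + (1 - 2 * ρ) ^ h) ^ m * 2 ^ k) ^ s)) fun y =>
    W.sum_matrixProb_indicator_le h0 h1 h hs.le (by linarith) y).trans_eq ?_
  rw [integral_const_mul, integral_fintype_prod_eq_prod (fun _ => W.tilted s)]
  simp

/-- The channel symmetry reduces heavy error events to the zero codeword. -/
theorem law_heavyErrorEvent {k m : ℕ} (h : ℕ) (P : Matrix (Fin k) (Fin m) (ZMod 2))
    (x : Fin k ⊕ Fin m → ZMod 2) :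
    (W.law x).real (W.heavyErrorEvent h P x) = (W.law 0).real (W.heavyErrorEvent h P 0) := by
  classical
  obtain ⟨π, hinv, hπ, hsym⟩ := W.symmetric
  have hsym' : ∀ y, W.dens 0 y = W.dens 1 (π y) := fun y => by rw [hsym, hinv y]
  let e : Y ≃ᵐ Y := ⟨hinv.toPerm, hπ.measurable, hπ.measurable⟩
  -- `Φ` applies the involution exactly where `x` has a 1, which translates channel inputs by `x`.
  let Φ : (Fin k ⊕ Fin m → Y) ≃ᵐ (Fin k ⊕ Fin m → Y) :=
    MeasurableEquiv.piCongrRight fun t => if x t = 1 then e else MeasurableEquiv.refl Y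
  have hΦ : MeasurePreserving Φ (Measure.pi fun _ => W.ref) (Measure.pi fun _ => W.ref) := by
    refine measurePreserving_pi
      (f := fun t => (if x t = 1 then e else MeasurableEquiv.refl Y : Y ≃ᵐ Y)) _ _
      fun t => ?_
    by_cases ht : x t = 1
    · simp only [ht, if_true]; exact hπ
    · simp only [ht, if_false]; exact MeasurePreserving.id _
  have hbit : ∀ a : ZMod 2, a = 0 ∨ a = 1 := by decide
  have h2 : (1 + 1 : ZMod 2) = 0 := by decide
  have hL : ∀ x' y, W.likelihood (x + x') (Φ y) = W.likelihood x' y := by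
    intro x' y
    refine Finset.prod_congr rfl fun t _ => ?_
    have hΦt : Φ y t = (if x t = 1 then e else MeasurableEquiv.refl Y) (y t) := rfl
    have he : ∀ y, e y = π y := fun _ => rfl
    rw [hΦt]
    rcases hbit (x t) with ht | ht <;> rcases hbit (x' t) with ht' | ht' <;>
      simp [ht, ht', h2, he, ← hsym, ← hsym']
  rw [W.law_real x (W.measurableSet_heavyErrorEvent h P x),
    W.law_real 0 (W.measurableSet_heavyErrorEvent h P 0),
    ← hΦ.integral_comp Φ.measurableEmbedding]
  refine integral_congr_ae (ae_of_all _ fun y => ?_)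
  have hx : W.likelihood x (Φ y) = W.likelihood 0 y := by
    rw [← hL 0 y, add_zero]
  simp only [Set.indicator_apply, heavyErrorEvent, Set.mem_ofPred_eq, hx, hL, zero_add]

end BIOSChannel

/-! ### Bit error rates of ML and MAP decoders -/

theorem Decoder.IsMeasurable.measurableSet_bit_ne {Y : Type*} [MeasurableSpace Y] {k m : ℕ}
    {d : Decoder Y k m} (hd : d.IsMeasurable) (P : Matrix (Fin k) (Fin m) (ZMod 2)) (i : Fin k)
    (b : ZMod 2) : MeasurableSet {y | d P y i ≠ b} := by
  have : {y | d P y i ≠ b} = ⋃ u ∈ {u : Fin k → ZMod 2 | u i ≠ b}, {y | d P y = u} := by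
    ext y; simp
  rw [this]
  exact MeasurableSet.biUnion (Set.to_countable _) fun u _ => hd P u

namespace BIOSChannel

variable {Y : Type*} [MeasurableSpace Y] (W : BIOSChannel Y)

theorem ber_nonneg {ρ : ℝ} (h0 : 0 ≤ ρ) (h1 : ρ ≤ 1) {k m : ℕ} (d : Decoder Y k m) :
    0 ≤ W.ber ρ d := by
  refine mul_nonneg (by positivity) (Finset.sum_nonneg fun i _ => Finset.sum_nonneg fun P _ =>
    mul_nonneg (matrixProb_nonneg h0 h1 P) (Finset.sum_nonneg fun u _ => by positivity))

/-- The left side is the expected Hamming distance between estimate and truth: at most `h` off the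
heavy error event, at most `k` on it. -/
theorem sum_law_bit_ne_le {k m : ℕ} {d : Decoder Y k m} (hd : d.IsMeasurable) (hML : W.IsML d)
    (h : ℕ) (P : Matrix (Fin k) (Fin m) (ZMod 2)) (u : Fin k → ZMod 2) :
    ∑ i, (W.law (encode P u)).real {y | d P y i ≠ u i} ≤
      h + k * (W.law 0).real (W.heavyErrorEvent h P 0) := by
  classical
  rw [← W.law_heavyErrorEvent h P (encode P u)]
  set H := W.heavyErrorEvent h P (encode P u) with hH
  have hHm : MeasurableSet H := W.measurableSet_heavyErrorEvent _ _ _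
  have hm := fun i => hd.measurableSet_bit_ne P i (u i)
  have hi : ∀ S : Set (Fin k ⊕ Fin m → Y), MeasurableSet S →
      Integrable (S.indicator (1 : (Fin k ⊕ Fin m → Y) → ℝ)) (W.law (encode P u)) :=
    fun S hS => (integrable_const (1 : ℝ)).indicator hS
  have e1 : ∀ S : Set (Fin k ⊕ Fin m → Y), MeasurableSet S →
      (W.law (encode P u)).real S = ∫ y, S.indicator (1 : (Fin k ⊕ Fin m → Y) → ℝ) y ∂(W.law (encode P u)) :=
    fun S hS => (integral_indicator_one hS).symm
  have e2 : (h : ℝ) + k * (W.law (encode P u)).real H =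
      ∫ y, ((h : ℝ) + k * H.indicator (1 : (Fin k ⊕ Fin m → Y) → ℝ) y) ∂(W.law (encode P u)) := by
    rw [integral_add (integrable_const _) ((hi H hHm).const_mul _), integral_const_mul, ← e1 H hHm]
    simp
  rw [e2, Finset.sum_congr rfl fun i _ => e1 _ (hm i),
    ← integral_finsetSum _ fun i _ => hi _ (hm i)]
  refine integral_mono (integrable_finsetSum _ fun i _ => hi _ (hm i))
    ((integrable_const _).add ((hi H hHm).const_mul _)) fun y => ?_
  have hcard : ∑ i, ({y | d P y i ≠ u i} : Set (Fin k ⊕ Fin m → Y)).indicator (1 : (Fin k ⊕ Fin m → Y) → ℝ) y =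
      (hammingDist (d P y) u : ℝ) := by
    simp only [Set.indicator_apply, Set.mem_ofPred_eq, Pi.one_apply, hammingDist]
    rw [Finset.sum_boole]
  simp only [hcard]
  by_cases hy : y ∈ H
  · have : (hammingDist (d P y) u : ℝ) ≤ k := by
      exact_mod_cast (hammingDist_le_card_fintype).trans_eq (Fintype.card_fin k)
    simp only [Set.indicator_of_mem hy, Pi.one_apply, mul_one]
    linarith [(Nat.cast_nonneg h : (0 : ℝ) ≤ h)]
  · simp only [Set.indicator_of_notMem hy, mul_zero, add_zero]
    by_contra hcon
    push Not at hcon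
    -- By linearity, an ML estimate at distance at least `h` is itself a heavy competitor.
    refine hy ⟨d P y - u, ?_, ?_⟩
    · have : hammingNorm (d P y - u) = hammingDist (d P y) u := by
        simp [hammingNorm, hammingDist, sub_ne_zero]
      rw [this]
      exact_mod_cast hcon.le
    · rw [← encode_add, add_sub_cancel]
      exact hML P y u

/-- The bit error rate of a maximum likelihood decoder is at most the relative weight `h / k` plus
the probability of a heavy error event. -/
theorem ber_le {ρ : ℝ} (h0 : 0 ≤ ρ) (h1 : ρ ≤ 1) {k m : ℕ} (hk : 0 < k) {d : Decoder Y k m}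
    (hd : d.IsMeasurable) (hML : W.IsML d) (h : ℕ) :
    W.ber ρ d ≤ (h : ℝ) / k + ∑ P : Matrix (Fin k) (Fin m) (ZMod 2), matrixProb ρ P *
      (W.law 0).real (W.heavyErrorEvent h P 0) := by
  have hk' : (0 : ℝ) < k := by exact_mod_cast hk
  have e : W.ber ρ d = ∑ P : Matrix (Fin k) (Fin m) (ZMod 2), matrixProb ρ P *
      ∑ u : Fin k → ZMod 2, (1 / 2 ^ k) *
        ((1 / (k : ℝ)) * ∑ i, (W.law (encode P u)).real {y | d P y i ≠ u i}) := by
    rw [ber, Finset.sum_comm, Finset.mul_sum]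
    refine Finset.sum_congr rfl fun P _ => ?_
    rw [← Finset.mul_sum, Finset.sum_comm, mul_left_comm, Finset.mul_sum]
    congr 1
    refine Finset.sum_congr rfl fun u _ => ?_
    rw [← Finset.mul_sum]; ring
  have hsum : (h : ℝ) / k = ∑ P : Matrix (Fin k) (Fin m) (ZMod 2), matrixProb ρ P * (h / k) := by
    rw [← Finset.sum_mul, sum_matrixProb, one_mul]
  rw [e, hsum, ← Finset.sum_add_distrib]
  refine Finset.sum_le_sum fun P _ => ?_
  rw [← mul_add]
  refine mul_le_mul_of_nonneg_left ?_ (matrixProb_nonneg h0 h1 P)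
  have hu : ∀ u : Fin k → ZMod 2, (1 / 2 ^ k : ℝ) *
      ((1 / (k : ℝ)) * ∑ i, (W.law (encode P u)).real {y | d P y i ≠ u i}) ≤
      (1 / 2 ^ k) * ((h : ℝ) / k + (W.law 0).real (W.heavyErrorEvent h P 0)) := by
    intro u
    refine mul_le_mul_of_nonneg_left ?_ (by positivity)
    rw [one_div, inv_mul_le_iff₀ hk', mul_add, mul_div_cancel₀ _ hk'.ne']
    exact W.sum_law_bit_ne_le hd hML h P u
  refine (Finset.sum_le_sum fun u _ => hu u).trans_eq ?_
  rw [Finset.sum_const]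
  simp

/-- Bitwise maximum a posteriori decoding minimizes the bit error rate. -/
theorem ber_le_ber_of_isMAP {ρ : ℝ} (h0 : 0 ≤ ρ) (h1 : ρ ≤ 1) {k m : ℕ} {d d' : Decoder Y k m}
    (hd : d.IsMeasurable) (hMAP : W.IsMAP d) (hd' : d'.IsMeasurable) :
    W.ber ρ d ≤ W.ber ρ d' := by
  classical
  refine mul_le_mul_of_nonneg_left (Finset.sum_le_sum fun i _ => Finset.sum_le_sum fun P _ =>
    mul_le_mul_of_nonneg_left ?_ (matrixProb_nonneg h0 h1 P)) (by positivity)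
  have hint : ∀ d : Decoder Y k m, d.IsMeasurable → ∀ u : Fin k → ZMod 2,
      Integrable (fun y => (1 / 2 ^ k : ℝ) * ({y | d P y i ≠ u i} : Set _).indicator
        (fun y => (W.likelihood (encode P u) y : ℝ)) y)
      (Measure.pi fun _ : Fin k ⊕ Fin m => W.ref) := fun d hd u =>
    ((W.integrable_likelihood _).indicator (hd.measurableSet_bit_ne P i (u i))).const_mul _
  have e : ∀ d : Decoder Y k m, d.IsMeasurable →
      ∑ u : Fin k → ZMod 2, (1 / 2 ^ k) * (W.law (encode P u)).real {y | d P y i ≠ u i} =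
      ∫ y, ∑ u : Fin k → ZMod 2, (1 / 2 ^ k : ℝ) * ({y | d P y i ≠ u i} : Set _).indicator
        (fun y => (W.likelihood (encode P u) y : ℝ)) y
        ∂(Measure.pi fun _ : Fin k ⊕ Fin m => W.ref) := by
    intro d hd
    rw [integral_finsetSum _ fun u _ => hint d hd u]
    refine Finset.sum_congr rfl fun u _ => ?_
    rw [W.law_real _ (hd.measurableSet_bit_ne P i (u i)), integral_const_mul]
  rw [e d hd, e d' hd']
  refine integral_mono (integrable_finsetSum _ fun u _ => hint d hd u)
    (integrable_finsetSum _ fun u _ => hint d' hd' u) fun y => ?_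
  set S : ZMod 2 → ℝ≥0 := fun b =>
    ∑ u : Fin k → ZMod 2 with u i = b, (1 / 2 ^ k) * W.likelihood (encode P u) y with hS
  set T : ℝ≥0 := ∑ u : Fin k → ZMod 2, (1 / 2 ^ k) * W.likelihood (encode P u) y with hT
  have hST : ∀ b, S b ≤ T := fun b =>
    Finset.sum_le_sum_of_subset_of_nonneg (Finset.filter_subset _ _) fun _ _ _ => zero_le
  -- Deciding `b` at `y` incurs the error mass `T - S b`, so maximizing the posterior `S b / T`
  -- minimizes the integrand pointwise.
  have hpt : ∀ b : ZMod 2, (∑ u : Fin k → ZMod 2, (1 / 2 ^ k : ℝ) *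
      (if b ≠ u i then (W.likelihood (encode P u) y : ℝ) else 0)) = T - S b := by
    intro b
    rw [eq_sub_iff_add_eq]
    simp only [hT, hS, Finset.sum_filter, NNReal.coe_sum, ← Finset.sum_add_distrib]
    refine Finset.sum_congr rfl fun u _ => ?_
    by_cases hb : u i = b
    · simp [hb]
    · simp [hb, Ne.symm hb]
  simp only [Set.indicator_apply, Set.mem_ofPred_eq]
  rw [hpt, hpt]
  refine sub_le_sub_left (NNReal.coe_le_coe.2 ?_) _
  have hle : S (d' P y i) / T ≤ S (d P y i) / T := hMAP P y i (d' P y i)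
  -- If `T = 0`, every posterior is `0 / 0 = 0` and the MAP condition says nothing, but then every
  -- `S b` vanishes.
  rcases eq_or_ne T 0 with hT0 | hT0
  · exact ((hST _).trans_eq hT0).trans zero_le
  · rwa [div_le_div_iff_of_pos_right (pos_iff_ne_zero.2 hT0)] at hle

/-- Provides the competitor for MAP decoding. Measurability holds because the tie-break depends only
on the set of maximizers, which takes finitely many values, each on a measurable set. -/
theorem exists_isML (k m : ℕ) : ∃ d : Decoder Y k m, d.IsMeasurable ∧ W.IsML d := by
  classical
  let best (P : Matrix (Fin k) (Fin m) (ZMod 2)) (y : Fin k ⊕ Fin m → Y) :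
      Set (Fin k → ZMod 2) :=
    {u | ∀ u', W.likelihood (encode P u') y ≤ W.likelihood (encode P u) y}
  have hne : ∀ P y, (best P y).Nonempty := fun P y =>
    Finite.exists_max fun u => W.likelihood (encode P u) y
  let pick (M : Set (Fin k → ZMod 2)) : Fin k → ZMod 2 := if h : M.Nonempty then h.some else 0
  have hpick : ∀ M : Set (Fin k → ZMod 2), M.Nonempty → pick M ∈ M := fun M hM => by
    simp only [pick, hM, dif_pos]; exact hM.some_mem
  refine ⟨fun P y => pick (best P y), fun P u => ?_, fun P y u => hpick _ (hne P y) u⟩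
  have hmem : ∀ u, MeasurableSet {y | u ∈ best P y} := fun u => by
    have : {y | u ∈ best P y} =
        ⋂ u', {y | W.likelihood (encode P u') y ≤ W.likelihood (encode P u) y} := by
      ext y; simp [best]
    rw [this]
    exact MeasurableSet.iInter fun u' =>
      measurableSet_le (W.measurable_likelihood (encode P u')) (W.measurable_likelihood (encode P u))
  have hset : {y | pick (best P y) = u} =
      ⋃ M ∈ {M : Set (Fin k → ZMod 2) | pick M = u}, ⋂ u', {y | u' ∈ best P y ↔ u' ∈ M} := by
    ext y
    simp only [Set.mem_ofPred_eq, Set.mem_iUnion, Set.mem_iInter, exists_prop]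
    constructor
    · exact fun h => ⟨_, h, fun _ => Iff.rfl⟩
    · rintro ⟨M, hM, hy⟩
      rw [show best P y = M from Set.ext hy, hM]
  rw [hset]
  refine MeasurableSet.biUnion (Set.to_countable _) fun M _ => MeasurableSet.iInter fun u' => ?_
  by_cases hu : u' ∈ M
  · simpa [hu] using hmem u'
  · have h := (hmem u').compl
    simp only [hu, iff_false]
    exact h

/-- Each factor is bounded by `1 + x ≤ exp x`; then `m η ≤ (k + m) η` and `k ≤ r (k + m)` collect
the exponent. -/
theorem heavy_bound_le_exp {ρ s η I r : ℝ} {k m h : ℕ} (h1 : ρ ≤ 1 / 2)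
    (hη : (1 - 2 * ρ) ^ h ≤ η) (hs : 0 < s)
    (hkr : (k : ℝ) ≤ r * (k + m)) {G : ℝ} (hG0 : 0 ≤ G) (hG : G ≤ 1 - s * I + 32 * s ^ 2) :
    ((1 + (1 - 2 * ρ) ^ h) ^ m * 2 ^ k) ^ s * G ^ (k + m) ≤
      Real.exp (-(s * (I - r * Real.log 2 - η - 32 * s)) * ((k : ℝ) + m)) := by
  have hδ : 0 ≤ (1 - 2 * ρ) ^ h := pow_nonneg (by linarith) _
  have a1 : (1 + (1 - 2 * ρ) ^ h) ^ m ≤ Real.exp (m * η) := by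
    rw [Real.exp_nat_mul]
    exact pow_le_pow_left₀ (by linarith) (by linarith [Real.add_one_le_exp η]) m
  have a2 : (2 : ℝ) ^ k = Real.exp (k * Real.log 2) := by
    rw [Real.exp_nat_mul, Real.exp_log (by norm_num)]
  have a3 : ((1 + (1 - 2 * ρ) ^ h) ^ m * 2 ^ k) ^ s ≤
      Real.exp (s * (m * η + k * Real.log 2)) := by
    rw [mul_comm s, Real.exp_mul, Real.exp_add, ← a2]
    exact Real.rpow_le_rpow (by positivity) (by gcongr) hs.le
  have a4 : G ^ (k + m) ≤ Real.exp ((k + m : ℕ) * (-s * I + 32 * s ^ 2)) := by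
    rw [Real.exp_nat_mul]
    exact pow_le_pow_left₀ hG0 (by linarith [Real.add_one_le_exp (-s * I + 32 * s ^ 2)]) _
  refine (mul_le_mul a3 a4 (pow_nonneg hG0 _) (Real.exp_nonneg _)).trans ?_
  rw [← Real.exp_add, Real.exp_le_exp]
  push_cast
  have hl : 0 < Real.log 2 := Real.log_pos (by norm_num)
  have b1 := mul_le_mul_of_nonneg_right hkr (mul_pos hs hl).le
  have b2 : 0 ≤ s * ((k : ℝ) * η) := by
    have : 0 ≤ η := hδ.trans hη
    positivity
  nlinarith

end BIOSChannel

/-! ### Asymptotics -/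

theorem tendsto_ber_of_isML {Y : Type*} [MeasurableSpace Y] (W : BIOSChannel Y)
    {ρ : ℝ} (hρ_pos : 0 < ρ) (hρ_le : ρ ≤ 1 / 2)
    {R : ℝ} (hR_pos : 0 < R) (hR_lt : R < W.capacity)
    {k : ℕ → ℕ} (hk : ∀ n, k n ≤ n)
    (hkR : Tendsto (fun n => (k n : ℝ) / (n : ℝ)) atTop (𝓝 R))
    (d : ∀ n, Decoder Y (k n) (n - k n)) (hd : ∀ n, (d n).IsMeasurable)
    (hML : ∀ n, W.IsML (d n)) :
    Tendsto (fun n => W.ber ρ (d n)) atTop (𝓝 0) := by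
  have hl : 0 < Real.log 2 := Real.log_pos (by norm_num)
  set I : ℝ := W.partialInfo 0 (1 / 2) * Real.log 2 with hI
  have hRI : 0 < W.partialInfo 0 (1 / 2) - R := sub_pos.2 (W.lt_partialInfo_half hR_pos hR_lt)
  -- The rates `k n / n` only converge to `R`; eventually they stay below `r`.
  obtain ⟨r, hRr, hrI⟩ := exists_between (sub_pos.1 hRI)
  set Δ : ℝ := I - r * Real.log 2 with hΔ
  have hΔ0 : 0 < Δ := by
    rw [hΔ, hI, ← sub_mul]; exact mul_pos (sub_pos.2 hrI) hl
  -- Chosen so that `32 s ≤ Δ / 4`; with bias at most `Δ / 4`, a margin of `Δ / 2` remains in the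
  -- exponent.
  set s : ℝ := min (1 / 2) (Δ / 128) with hs
  have hs0 : 0 < s := lt_min (by norm_num) (by positivity)
  have hs2 : s ≤ 1 / 2 := min_le_left _ _
  have hsΔ : 32 * s ≤ Δ / 4 := by linarith [min_le_right (1 / 2) (Δ / 128)]
  have hkn : Tendsto (fun n => (k n : ℝ)) atTop atTop := by
    refine (hkR.pos_mul_atTop hR_pos tendsto_natCast_atTop_atTop).congr' ?_
    filter_upwards [eventually_gt_atTop 0] with n hn
    have : (n : ℝ) ≠ 0 := by exact_mod_cast hn.ne'
    field_simp
  have hdecay : Tendsto (fun n : ℕ => Real.exp (-(s * (Δ / 2)) * n)) atTop (𝓝 0) := by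
    refine Real.tendsto_exp_atBot.comp ?_
    exact tendsto_natCast_atTop_atTop.const_mul_atTop_of_neg (by
      have : 0 < s * (Δ / 2) := by positivity
      linarith)
  rw [Metric.tendsto_atTop']
  intro ε hε
  -- This weight threshold costs at most `ε / 2` in bit error rate, yet tends to infinity, so the
  -- parity bias vanishes.
  have hh : Tendsto (fun n => ⌊ε / 2 * (k n : ℝ)⌋₊) atTop atTop :=
    tendsto_nat_floor_atTop.comp (hkn.const_mul_atTop (by positivity))
  have hδ : Tendsto (fun n => (1 - 2 * ρ) ^ ⌊ε / 2 * (k n : ℝ)⌋₊) atTop (𝓝 0) :=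
    (tendsto_pow_atTop_nhds_zero_of_lt_one (by linarith) (by linarith)).comp hh
  have hev : ∀ᶠ n in atTop, dist (W.ber ρ (d n)) 0 < ε := by
    filter_upwards [hkn.eventually_gt_atTop 0, hδ.eventually_le_const (by positivity : 0 < Δ / 4),
      hdecay.eventually_lt_const (by positivity : 0 < ε / 2), hkR.eventually_lt_const hRr,
      eventually_gt_atTop 0] with n hk0 hη hexp hkr hn
    have hn' : (0 : ℝ) < n := by exact_mod_cast hn
    have hkm : (k n : ℝ) + ((n - k n : ℕ) : ℝ) = n := by
      rw [Nat.cast_sub (hk n)]; ring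
    rw [Real.dist_eq, sub_zero, abs_of_nonneg (W.ber_nonneg hρ_pos.le (by linarith) _)]
    have b1 := W.ber_le hρ_pos.le (by linarith : ρ ≤ 1) (by exact_mod_cast hk0) (hd n) (hML n)
      ⌊ε / 2 * (k n : ℝ)⌋₊
    have b2 : (⌊ε / 2 * (k n : ℝ)⌋₊ : ℝ) / k n ≤ ε / 2 := by
      rw [div_le_iff₀ hk0]
      exact Nat.floor_le (by positivity)
    have b3 := W.sum_matrixProb_law_heavyErrorEvent_le hρ_pos.le hρ_le (k := k n) (m := n - k n)
      ⌊ε / 2 * (k n : ℝ)⌋₊ hs0 hs2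
    have b4 := BIOSChannel.heavy_bound_le_exp (I := I) (r := r) (k := k n) (m := n - k n) hρ_le hη
      hs0 (by rw [hkm]; exact ((div_lt_iff₀ hn').1 hkr).le)
      (integral_nonneg (W.tilted_nonneg s)) (W.integral_tilted_le hs0 hs2)
    rw [hkm, ← hΔ] at b4
    have b5 : Real.exp (-(s * (Δ - Δ / 4 - 32 * s)) * n) ≤ Real.exp (-(s * (Δ / 2)) * n) := by
      rw [Real.exp_le_exp]
      refine mul_le_mul_of_nonneg_right (neg_le_neg ?_) hn'.le
      exact mul_le_mul_of_nonneg_left (by linarith) hs0.le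
    linarith
  obtain ⟨N, hN⟩ := eventually_atTop.1 hev
  exact ⟨N, fun n hn => hN n hn.le⟩

theorem theorem1 {Y : Type*} [MeasurableSpace Y] (W : BIOSChannel Y)
    (ρ : ℝ) (hρ_pos : 0 < ρ) (hρ_le : ρ ≤ 1 / 2)
    (R : ℝ) (hR_pos : 0 < R) (hR_lt : R < W.capacity)
    (k : ℕ → ℕ) (hk : ∀ n, k n ≤ n)
    (hkR : Tendsto (fun n => (k n : ℝ) / (n : ℝ)) atTop (𝓝 R)) :
    (∀ d : ∀ n, Decoder Y (k n) (n - k n),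
      (∀ n, (d n).IsMeasurable) → (∀ n, W.IsML (d n)) →
        Tendsto (fun n => W.ber ρ (d n)) atTop (𝓝 0)) ∧
    (∀ d : ∀ n, Decoder Y (k n) (n - k n),
      (∀ n, (d n).IsMeasurable) → (∀ n, W.IsMAP (d n)) →
        Tendsto (fun n => W.ber ρ (d n)) atTop (𝓝 0)) := by
  refine ⟨fun d hd hML => tendsto_ber_of_isML W hρ_pos hρ_le hR_pos hR_lt hk hkR d hd hML,
    fun d hd hMAP => ?_⟩
  choose d' hd' hML' using fun n => W.exists_isML (k n) (n - k n)
  exact squeeze_zero (fun n => W.ber_nonneg hρ_pos.le (by linarith) _)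
    (fun n => W.ber_le_ber_of_isMAP hρ_pos.le (by linarith) (hd n) (hMAP n) (hd' n))
    (tendsto_ber_of_isML W hρ_pos hρ_le hR_pos hR_lt hk hkR d' hd' hML')
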